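/- Let $\mu_X,\mu_Y\in\mathbb{R}$, $\rho\in(-1,1)$ and $n\ge 1$. Let $Z_1,\dots,Z_n$ be independent copies of $Z=XY$, where $(X,Y)$ is a bivariate normal random vector with mean vector $(\mu_X,\mu_Y)$, variances $\sigma_X^2=\sigma_Y^2=1$ and correlation coefficient $\rho$, and let $\overline{Z}_n=n^{-1}\sum_{i=1}^n Z_i$. Then $\overline{Z}_n$ has a probability density function (with respect to Lebesgue measure) that is infinitely differentiable on $\mathbb{R}\setminus\{0\}$, and every probability density function $p_n:\mathbb{R}\to[0,\infty)$ of $\overline{Z}_n$ satisfies, at every point $x\in\mathbb{R}$ at which $p_n$ is $C^4$ (that is, four times continuously differentiable in a neighbourhood of $x$), the fourth-order linear ordinary differential equation $$\begin{aligned} &(1-\rho^2)^2\,x\,p_n^{(4)}(x)+(1-\rho^2)\big((1-\rho^2)(4-n)-4\rho n x\big)p_n^{(3)}(x)\\ &\quad+n\big((6\rho^2-2)nx-12\rho(1-\rho^2)+n(3\rho(1-\rho^2)+\rho\mu_Y^2-\rho^2\mu_X\mu_Y-\mu_X\mu_Y+\rho\mu_X^2)\big)p_n''(x)\\ &\quad+n^2\big(2(6\rho^2-2)-n(2\rho\mu_X\mu_Y-\mu_X^2-\mu_Y^2+3\rho^2-1)+4\rho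 nx\big)p_n'(x)\\ &\quad+n^3\big(4\rho+n(x-\mu_X\mu_Y-\rho)\big)p_n(x)=0. \end{aligned}$$ In particular, the density that is smooth on $\mathbb{R}\setminus\{0\}$ satisfies this equation for every $x\neq 0$. -/

import Mathlib

open MeasureTheory ProbabilityTheory
open scoped ContDiff

noncomputable section

/-- The bivariate normal distribution with mean vector `(μX, μY)`, variances `(σX ^ 2, σY ^ 2)`
and correlation coefficient `ρ`. -/
def bivariateNormal (μX μY σX σY ρ : ℝ) : Measure (EuclideanSpace ℝ (Fin 2)) :=
  multivariateGaussian !₂[μX, μY] !![σX ^ 2, ρ * σX * σY; ρ * σX * σY, σY ^ 2]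

/-- The product normal distribution `PN(μX, μY; σX ^ 2, σY ^ 2; ρ)`: the law of `X * Y` where
`(X, Y)` is bivariate normal. -/
def productNormal (μX μY σX σY ρ : ℝ) : Measure ℝ :=
  (bivariateNormal μX μY σX σY ρ).map (fun v => v 0 * v 1)

/-- `p : ℝ → ℝ` is a probability density function (with respect to Lebesgue measure) of the
real random variable `W` on the probability space `(Ω, P)`. -/
structure IsPDF {Ω : Type*} [MeasurableSpace Ω] (p : ℝ → ℝ) (W : Ω → ℝ) (P : Measure Ω) :
    Prop where
  measurable : Measurable p
  nonneg : ∀ x, 0 ≤ p x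
  hasLaw : HasLaw W (volume.withDensity (fun x => ENNReal.ofReal (p x))) P

end

/-! ### Law and characteristic function of one product -/

open scoped FourierTransform

/-! With `X = A + B` and `Y = A - B` for independent normal `A` and `B`, the product is `A² - B²`,
so its characteristic function is explicit: two factors of the form `(1 + cs)^(-1/2) exp(as / (1 +
cs))` with `s = It`. The characteristic function `φ` of the mean is a rescaled `n`-th power of this,
and its logarithmic derivative is rational in `s`, with denominator a quartic, the square of a
product of two linear factors.

Clearing that denominator (`meanLogDeriv_polynomial_relation`) gives a relation between `φ'` and `φ`
with polynomial coefficients of degree at most 4. On the Fourier side `φ'` corresponds to `x p` and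
multiplication by `s` to differentiation, so the relation is a weak fourth-order equation for `p`. A
density is arbitrary on null sets, so the equation is tested against bump functions and becomes
pointwise wherever `p` is `C^4` (`sum_iteratedDeriv_eq_zero_of_fourier`).

For smoothness, each derivative of `φ` gains a power of decay: the `k`-th is `O(|t|^(-k-1))`,
because the logarithmic derivative is a polynomial without constant term in the inverses of the
linear factors (`PolyDecay`). Hence `x^(k+1) p` agrees almost everywhere with a `C^k` function, and
dividing by the power of `x` gives smoothness off the origin
(`exists_contDiffOn_ae_eq_of_fourier_decay`). -/

open Complex in
lemma Complex.ofReal_mul_cpow {r : ℝ} (hr : 0 < r) {w : ℂ} (hw : w ≠ 0) (s : ℂ) :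
    ((r : ℂ) * w) ^ s = (r : ℂ) ^ s * w ^ s := by
  have hr' : (r : ℂ) ≠ 0 := by exact_mod_cast hr.ne'
  rw [cpow_def_of_ne_zero (mul_ne_zero hr' hw), cpow_def_of_ne_zero hr', cpow_def_of_ne_zero hw,
    log_ofReal_mul hr hw, ← Complex.exp_add, ofReal_log hr.le, add_mul]

-- A Gaussian integral with complex leading coefficient `-z / (2v)`, where `z = 1 - 2vIt`. Since `Re
-- z = 1`, it converges and the principal branch of the square root is the right one.
open Complex in
lemma charFun_map_sq_gaussianReal (m : ℝ) {v : NNReal} (hv : v ≠ 0) (t : ℝ) :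
    charFun ((gaussianReal m v).map (fun x => x ^ 2)) t =
      (1 - 2 * v * (I * t)) ^ (-(1 / 2) : ℂ) * exp (m ^ 2 * (I * t) / (1 - 2 * v * (I * t))) := by
  have hv0 : (0 : ℝ) < v := by positivity
  have hvc : (v : ℂ) ≠ 0 := by exact_mod_cast hv0.ne'
  rw [charFun_apply_real, integral_map (by fun_prop) (by fun_prop),
    integral_gaussianReal_eq_integral_smul hv]
  set z : ℂ := 1 - 2 * v * (I * t) with hz
  have hzre : z.re = 1 := by simp [hz]
  have hz0 : z ≠ 0 := fun h => by simp [h] at hzre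
  have h1 : ∀ x : ℝ, gaussianPDFReal m v x • cexp (t * ((x ^ 2 : ℝ) : ℂ) * I) =
      ((√(2 * Real.pi * v))⁻¹ : ℝ) *
        cexp ((-(z / (2 * v))) * x ^ 2 + (m / v) * x + (-(m ^ 2 / (2 * v)))) := by
    intro x
    rw [gaussianPDFReal_def, real_smul, ofReal_mul, mul_assoc, ofReal_exp, ← Complex.exp_add]
    congr 2
    push_cast
    rw [hz]
    field_simp
    ring
  simp_rw [h1]
  have hre : (-(z / (2 * v)) : ℂ).re < 0 := by
    have : (-(z / (2 * v)) : ℂ) = ((-(1 / (2 * v)) : ℝ) : ℂ) * z := by push_cast; field_simp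
    rw [this, re_ofReal_mul, hzre]
    simp; positivity
  rw [integral_const_mul, integral_cexp_quadratic hre]
  rw [← mul_assoc]
  congr 1
  · have h2 : (Real.pi / -(-(z / (2 * v))) : ℂ) = ((2 * Real.pi * v : ℝ) : ℂ) * z⁻¹ := by
      push_cast; field_simp
    have hp : (0 : ℝ) < 2 * Real.pi * v := by positivity
    have harg : z.arg ≠ Real.pi := by
      intro h
      have := (arg_eq_pi_iff.1 h).1
      linarith
    rw [h2, ofReal_mul_cpow hp (inv_ne_zero hz0), inv_cpow _ _ harg, cpow_neg, ← mul_assoc]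
    have : (((2 * Real.pi * v : ℝ) : ℂ) ^ (1 / 2 : ℂ)) = ((√(2 * Real.pi * v) : ℝ) : ℂ) := by
      rw [Real.sqrt_eq_rpow, ofReal_cpow hp.le]; simp
    rw [this, ← ofReal_mul, inv_mul_cancel₀ (by positivity)]
    simp
  · congr 1
    field_simp
    rw [hz]
    ring

lemma charFun_map_neg_sq_gaussianReal (m : ℝ) (v : NNReal) (t : ℝ) :
    charFun ((gaussianReal m v).map (fun x => -x ^ 2)) t =
      charFun ((gaussianReal m v).map (fun x => x ^ 2)) (-t) := by
  have : (fun x : ℝ => -x ^ 2) = fun x => (-1) * x ^ 2 := by ext; ring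
  rw [this, charFun_map_mul_comp (by fun_prop)]
  simp

lemma posSemidef_correlation {ρ : ℝ} (hρ : ρ ∈ Set.Ioo (-1 : ℝ) 1) :
    (!![1, ρ; ρ, 1] : Matrix (Fin 2) (Fin 2) ℝ).PosSemidef := by
  refine Matrix.PosSemidef.of_dotProduct_mulVec_nonneg ?_ fun x => ?_
  · ext i j; fin_cases i <;> fin_cases j <;> simp
  · simp [dotProduct, Matrix.mulVec, Fin.sum_univ_two]
    -- The form equals `(1 + ρ)/2 (x₀ + x₁)² + (1 - ρ)/2 (x₀ - x₁)²`.
    nlinarith [sq_nonneg (x 0 + x 1), sq_nonneg (x 0 - x 1), hρ.1, hρ.2]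

open Complex in
/-- A bivariate normal vector with unit variances is `(A + B, A - B)` with `A`, `B` independent
normal variables. -/
lemma bivariateNormal_one_one_eq_map (μX μY : ℝ) {ρ : ℝ} (hρ : ρ ∈ Set.Ioo (-1 : ℝ) 1) :
    bivariateNormal μX μY 1 1 ρ =
      ((gaussianReal ((μX + μY) / 2) ((1 + ρ) / 2).toNNReal).prod
        (gaussianReal ((μX - μY) / 2) ((1 - ρ) / 2).toNNReal)).map
          (fun q => !₂[q.1 + q.2, q.1 - q.2]) := by
  have hm : Measurable (fun q : ℝ × ℝ => !₂[q.1 + q.2, q.1 - q.2]) := by fun_prop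
  have : IsProbabilityMeasure (bivariateNormal μX μY 1 1 ρ) := by
    unfold bivariateNormal; infer_instance
  have := Measure.isProbabilityMeasure_map
    (μ := (gaussianReal ((μX + μY) / 2) ((1 + ρ) / 2).toNNReal).prod
        (gaussianReal ((μX - μY) / 2) ((1 - ρ) / 2).toNNReal)) hm.aemeasurable
  apply Measure.ext_of_charFun
  ext t
  rw [bivariateNormal]
  simp only [one_pow, mul_one]
  rw [charFun_multivariateGaussian (posSemidef_correlation hρ), charFun_apply,
    integral_map hm.aemeasurable (by fun_prop)]
  have h1 : ∀ q : ℝ × ℝ, cexp (inner ℝ !₂[q.1 + q.2, q.1 - q.2] t * I) =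
      cexp ((t 0 + t 1 : ℝ) * q.1 * I) * cexp ((t 0 - t 1 : ℝ) * q.2 * I) := by
    intro q
    rw [← Complex.exp_add]
    congr 1
    simp [PiLp.inner_apply, Fin.sum_univ_two]
    ring
  simp_rw [h1]
  rw [integral_prod_mul (fun a : ℝ => cexp ((t 0 + t 1 : ℝ) * a * I))
    (fun b : ℝ => cexp ((t 0 - t 1 : ℝ) * b * I)), ← charFun_apply_real, ← charFun_apply_real,
    charFun_gaussianReal, charFun_gaussianReal, ← Complex.exp_add]
  have e1 : (0 : ℝ) ≤ (1 + ρ) / 2 := by linarith [hρ.1]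
  have e2 : (0 : ℝ) ≤ (1 - ρ) / 2 := by linarith [hρ.2]
  congr 1
  rw [Real.coe_toNNReal _ e1, Real.coe_toNNReal _ e2]
  simp [PiLp.inner_apply, Fin.sum_univ_two, dotProduct, Matrix.mulVec]
  ring

lemma productNormal_one_one_eq_map (μX μY : ℝ) {ρ : ℝ} (hρ : ρ ∈ Set.Ioo (-1 : ℝ) 1) :
    productNormal μX μY 1 1 ρ =
      ((gaussianReal ((μX + μY) / 2) ((1 + ρ) / 2).toNNReal).prod
        (gaussianReal ((μX - μY) / 2) ((1 - ρ) / 2).toNNReal)).map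
          (fun q => q.1 ^ 2 + -q.2 ^ 2) := by
  rw [productNormal, bivariateNormal_one_one_eq_map μX μY hρ, Measure.map_map (by fun_prop) (by fun_prop)]
  congr 1
  ext q
  simp
  ring

lemma productNormal_one_one_eq_conv (μX μY : ℝ) {ρ : ℝ} (hρ : ρ ∈ Set.Ioo (-1 : ℝ) 1) :
    productNormal μX μY 1 1 ρ =
      (gaussianReal ((μX + μY) / 2) ((1 + ρ) / 2).toNNReal).map (fun x => x ^ 2) ∗
        (gaussianReal ((μX - μY) / 2) ((1 - ρ) / 2).toNNReal).map (fun x => -x ^ 2) := by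
  rw [productNormal_one_one_eq_map μX μY hρ, Measure.conv,
    Measure.map_prod_map _ _ (by fun_prop) (by fun_prop), Measure.map_map (by fun_prop) (by fun_prop)]
  rfl

instance isProbabilityMeasure_productNormal (μX μY σX σY ρ : ℝ) :
    IsProbabilityMeasure (productNormal μX μY σX σY ρ) := by
  unfold productNormal bivariateNormal
  exact Measure.isProbabilityMeasure_map (by fun_prop)

/-! ### Absolute continuity, moments and explicit characteristic function of the product -/

/-- The preimage of a null set under squaring is a null set. -/
lemma volume_preimage_sq_eq_zero {s : Set ℝ} (hs : volume s = 0) :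
    volume ((fun x : ℝ => x ^ 2) ⁻¹' s) = 0 := by
  have h0 : volume (s ∩ Set.Ioi 0) = 0 := measure_mono_null Set.inter_subset_left hs
  have hd : DifferentiableOn ℝ Real.sqrt (s ∩ Set.Ioi 0) := fun x hx =>
    (Real.hasDerivAt_sqrt (ne_of_gt hx.2)).differentiableAt.differentiableWithinAt
  have h1 := addHaar_image_eq_zero_of_differentiableOn_of_addHaar_eq_zero volume hd h0
  have h2 := addHaar_image_eq_zero_of_differentiableOn_of_addHaar_eq_zero volume hd.neg h0
  refine measure_mono_null (t := (Real.sqrt '' (s ∩ Set.Ioi 0) ∪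
    (-Real.sqrt) '' (s ∩ Set.Ioi 0)) ∪ {0}) ?_ ?_
  · intro x hx
    rcases lt_trichotomy x 0 with h | h | h
    · refine Or.inl (Or.inr ⟨x ^ 2, ⟨hx, sq_pos_of_neg h⟩, ?_⟩)
      simp [Real.sqrt_sq_eq_abs, abs_of_neg h]
    · exact Or.inr h
    · refine Or.inl (Or.inl ⟨x ^ 2, ⟨hx, sq_pos_of_pos h⟩, ?_⟩)
      simp [Real.sqrt_sq_eq_abs, abs_of_pos h]
  · exact measure_union_null (measure_union_null h1 h2) (by simp)

lemma map_neg_sq_gaussianReal_absolutelyContinuous (m : ℝ) {v : NNReal} (hv : v ≠ 0) :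
    (gaussianReal m v).map (fun x => -x ^ 2) ≪ volume := by
  refine Measure.AbsolutelyContinuous.mk fun s hs h => ?_
  rw [Measure.map_apply (by fun_prop) hs]
  apply gaussianReal_absolutelyContinuous m hv
  exact volume_preimage_sq_eq_zero (s := (fun x => -x) ⁻¹' s) (by simpa using h)

/-- A convolution is absolutely continuous as soon as one factor is; here the factor `-B²`. -/
lemma productNormal_one_one_absolutelyContinuous (μX μY : ℝ) {ρ : ℝ}
    (hρ : ρ ∈ Set.Ioo (-1 : ℝ) 1) : productNormal μX μY 1 1 ρ ≪ volume := by
  rw [productNormal_one_one_eq_conv μX μY hρ]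
  refine Measure.conv_absolutelyContinuous
    (map_neg_sq_gaussianReal_absolutelyContinuous _ ?_)
  simp only [ne_eq, Real.toNNReal_eq_zero, not_le]
  linarith [hρ.2]

lemma memLp_sq_gaussianReal (m : ℝ) (v : NNReal) (k : ℕ) :
    MemLp (fun x : ℝ => x ^ 2) k (gaussianReal m v) := by
  have h := (memLp_id_gaussianReal' (μ := m) (v := v) (k * 2) (by finiteness)).norm_rpow_div 2
  rw [ENNReal.mul_div_cancel_right (by simp) (by simp)] at h
  simpa using h

lemma memLp_id_productNormal_one_one (μX μY : ℝ) {ρ : ℝ} (hρ : ρ ∈ Set.Ioo (-1 : ℝ) 1) (k : ℕ) :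
    MemLp id k (productNormal μX μY 1 1 ρ) := by
  rw [productNormal_one_one_eq_map μX μY hρ, memLp_map_measure_iff (by fun_prop) (by fun_prop)]
  exact ((memLp_sq_gaussianReal _ _ k).comp_fst _).add ((memLp_sq_gaussianReal _ _ k).neg.comp_snd _)

open Complex in
lemma charFun_productNormal_one_one (μX μY : ℝ) {ρ : ℝ} (hρ : ρ ∈ Set.Ioo (-1 : ℝ) 1) (t : ℝ) :
    charFun (productNormal μX μY 1 1 ρ) t =
      (1 - (1 + ρ) * (I * t)) ^ (-(1 / 2) : ℂ) *
          exp (((μX + μY) / 2) ^ 2 * (I * t) / (1 - (1 + ρ) * (I * t))) *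
        ((1 + (1 - ρ) * (I * t)) ^ (-(1 / 2) : ℂ) *
          exp (-((μX - μY) / 2) ^ 2 * (I * t) / (1 + (1 - ρ) * (I * t)))) := by
  have e1 : (0 : ℝ) < (1 + ρ) / 2 := by linarith [hρ.1]
  have e2 : (0 : ℝ) < (1 - ρ) / 2 := by linarith [hρ.2]
  rw [productNormal_one_one_eq_conv μX μY hρ, charFun_conv, charFun_map_neg_sq_gaussianReal,
    charFun_map_sq_gaussianReal _ (by simpa using e1), charFun_map_sq_gaussianReal _ (by simpa using e2),
    Real.coe_toNNReal _ e1.le, Real.coe_toNNReal _ e2.le]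
  push_cast
  have : (1 - 2 * ((1 - ρ) / 2) * (I * -t) : ℂ) = 1 + (1 - ρ) * (I * t) := by ring
  have : (1 - 2 * ((1 + ρ) / 2) * (I * t) : ℂ) = 1 - (1 + ρ) * (I * t) := by ring
  simp only [*]
  congr 3
  ring

/-! ### Fourier inversion, and smoothness from decay -/

lemma integral_fourier_smul_eq_flip {f g : ℝ → ℂ} (hf : Integrable f) (hg : Integrable g) :
    ∫ ξ, 𝓕 f ξ • g ξ = ∫ x, f x • 𝓕 g x := by
  have := VectorFourier.integral_fourierIntegral_smul_eq_flip (μ := volume) (ν := volume)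
    (L := innerₗ ℝ) (f := f) (g := g) Real.continuous_fourierChar continuous_inner hf hg
  rwa [flip_innerₗ] at this

lemma integral_fourierInv_smul_eq_flip {f g : ℝ → ℂ} (hf : Integrable f) (hg : Integrable g) :
    ∫ ξ, 𝓕⁻ f ξ • g ξ = ∫ x, f x • 𝓕⁻ g x := by
  have h1 := integral_fourier_smul_eq_flip hf.comp_neg hg
  have h2 : ∀ x, 𝓕⁻ g x = 𝓕 g (-x) := Real.fourierInv_eq_fourier_neg g
  rw [Real.fourierInv_eq_fourier_comp_neg, h1]
  simp_rw [h2]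
  rw [← integral_neg_eq_self]
  simp

lemma integrable_norm_of_le_inv_sq {E : Type*} [NormedAddCommGroup E] {f : ℝ → E}
    (hf : AEStronglyMeasurable f) {C : ℝ} (h : ∀ x, ‖f x‖ ≤ C / (1 + |x|) ^ 2) : Integrable f := by
  refine (integrable_inv_one_add_sq.const_mul C).mono' hf (ae_of_all _ fun x => (h x).trans ?_)
  have hC : 0 ≤ C := by
    have := (norm_nonneg _).trans (h 0)
    simpa using this
  rw [div_eq_mul_inv]
  gcongr
  nlinarith [abs_nonneg x, sq_abs x]

/-- Each derivative costs one factor `ξ`; after `N` of them an integrable `(1 + |ξ|)^(-2)` is left.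
-/
lemma ContDiff.fourierInv_of_norm_le {F : ℝ → ℂ} (hF : Continuous F) {N : ℕ} {C : ℝ}
    (h : ∀ ξ, ‖F ξ‖ ≤ C / (1 + |ξ|) ^ (N + 2)) : ContDiff ℝ N (𝓕⁻ F) := by
  have hC : 0 ≤ C := by
    have := (norm_nonneg _).trans (h 0)
    simpa using this
  have : 𝓕⁻ F = 𝓕 F ∘ fun x => -x := funext (Real.fourierInv_eq_fourier_neg F)
  rw [this]
  refine (Real.contDiff_fourier (N := N) fun n hn => ?_).comp contDiff_neg
  refine integrable_norm_of_le_inv_sq (C := C) (by fun_prop) fun x => ?_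
  have hn' : n ≤ N := by exact_mod_cast hn
  rw [norm_mul, norm_pow, norm_norm, norm_norm]
  calc ‖x‖ ^ n * ‖F x‖ ≤ (1 + |x|) ^ N * (C / (1 + |x|) ^ (N + 2)) := by
        refine mul_le_mul ?_ (h x) (norm_nonneg _) (by positivity)
        calc ‖x‖ ^ n ≤ (1 + |x|) ^ n := by rw [Real.norm_eq_abs]; gcongr; linarith
          _ ≤ (1 + |x|) ^ N := pow_le_pow_right₀ (by linarith [abs_nonneg x]) hn'
    _ = C / (1 + |x|) ^ 2 := by
        rw [pow_add]; field_simp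

/-- A smooth compactly supported function is the Fourier transform of a Schwartz function. -/
lemma exists_schwartz_fourier_eq {g : ℝ → ℝ} (hg : ContDiff ℝ ∞ g) (hgs : HasCompactSupport g) :
    ∃ h : SchwartzMap ℝ ℂ, 𝓕 (h : ℝ → ℂ) = (fun x => (g x : ℂ)) ∧
      (h : ℝ → ℂ) = 𝓕⁻ (fun x => (g x : ℂ)) := by
  have h1 : HasCompactSupport (fun x => (g x : ℂ)) := hgs.comp_left (g := ((↑) : ℝ → ℂ)) rfl
  have h2 : ContDiff ℝ ∞ (fun x => (g x : ℂ)) := Complex.ofRealCLM.contDiff.comp hg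
  refine ⟨𝓕⁻ (h1.toSchwartzMap h2), ?_, ?_⟩
  · rw [← SchwartzMap.fourier_coe, FourierTransform.fourier_fourierInv_eq]
    rfl
  · rw [SchwartzMap.fourierInv_coe]
    rfl

/-- Inversion without continuity of `f`, by duality: for a test function `g`, moving both transforms
across the integral gives `∫ g 𝓕⁻𝓕f = ∫ (𝓕𝓕⁻g) f = ∫ g f`. -/
theorem Integrable.ae_eq_fourierInv_fourier {f : ℝ → ℂ} (hf : Integrable f)
    (hF : Integrable (𝓕 f)) : f =ᵐ[volume] 𝓕⁻ (𝓕 f) := by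
  have hc : Continuous (𝓕⁻ (𝓕 f)) := by
    have : 𝓕⁻ (𝓕 f) = 𝓕 (𝓕 f) ∘ fun x => -x := funext (Real.fourierInv_eq_fourier_neg _)
    rw [this]
    exact (VectorFourier.fourierIntegral_continuous Real.continuous_fourierChar
      (by exact continuous_inner) hF).comp continuous_neg
  refine ae_eq_of_integral_contDiff_smul_eq hf.locallyIntegrable hc.locallyIntegrable ?_
  intro g hg hgs
  obtain ⟨h, hh, hh'⟩ := exists_schwartz_fourier_eq hg hgs
  have e : ∀ (u : ℝ → ℂ) x, g x • u x = (g x : ℂ) • u x := fun u x => by simp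
  simp_rw [e]
  have hgi : Integrable (fun x => (g x : ℂ)) :=
    (hg.continuous.integrable_of_hasCompactSupport hgs).ofReal
  rw [← integral_fourierInv_smul_eq_flip hgi hF, ← hh', ← integral_fourier_smul_eq_flip h.integrable hf]
  rw [hh]

/-- A density is smooth away from the origin if the Fourier transforms of its products with powers
decay fast enough. -/
theorem exists_contDiffOn_ae_eq_of_fourier_decay {p : ℝ → ℝ} (hp0 : ∀ x, 0 ≤ p x)
    (hpi : ∀ k : ℕ, Integrable (fun x => x ^ k * p x))
    (hdec : ∀ k : ℕ, ∃ C : ℝ, ∀ ξ : ℝ,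
      ‖𝓕 (fun x : ℝ => ((x ^ k * p x : ℝ) : ℂ)) ξ‖ ≤ C / (1 + |ξ|) ^ (k + 1)) :
    ∃ q : ℝ → ℝ, Measurable q ∧ (∀ x, 0 ≤ q x) ∧ q =ᵐ[volume] p ∧ ContDiffOn ℝ ∞ q {0}ᶜ := by
  -- The power starts at 1 because the transform of `p` itself is only assumed `O(1/|ξ|)`, which
  -- does not make it integrable.
  let F : ℕ → ℝ → ℂ := fun k => 𝓕 (fun x : ℝ => ((x ^ (k + 1) * p x : ℝ) : ℂ))
  let Q : ℕ → ℝ → ℂ := fun k => 𝓕⁻ (F k)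
  have hFc : ∀ k, Continuous (F k) := fun k =>
    VectorFourier.fourierIntegral_continuous Real.continuous_fourierChar
      (by exact continuous_inner) (hpi (k + 1)).ofReal
  have hQd : ∀ k : ℕ, ContDiff ℝ k (Q k) := fun k => by
    obtain ⟨C, hC⟩ := hdec (k + 1)
    exact ContDiff.fourierInv_of_norm_le (hFc k) hC
  have hFi : ∀ k, Integrable (F k) := fun k => by
    obtain ⟨C, hC⟩ := hdec (k + 1)
    have hC0 : 0 ≤ C := by
      have := (norm_nonneg _).trans (hC 0)
      simpa using this
    refine integrable_norm_of_le_inv_sq (C := C) (hFc k).aestronglyMeasurable fun x =>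
      (hC x).trans ?_
    gcongr
    · linarith [abs_nonneg x]
    · omega
  have hQae : ∀ k, (fun x : ℝ => ((x ^ (k + 1) * p x : ℝ) : ℂ)) =ᵐ[volume] Q k := fun k =>
    Integrable.ae_eq_fourierInv_fourier (hpi (k + 1)).ofReal (hFi k)
  have hQ0 : ∀ k : ℕ, ∀ x : ℝ, (x : ℂ) ^ k * Q 0 x = Q k x := by
    intro k
    have hc : Continuous fun x : ℝ => (x : ℂ) ^ k * Q 0 x :=
      (by fun_prop : Continuous fun x : ℝ => (x : ℂ) ^ k).mul (hQd 0).continuous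
    refine fun x => congrFun ((hc.ae_eq_iff_eq volume (hQd k).continuous).1 ?_) x
    filter_upwards [hQae 0, hQae k] with x h0 hk
    rw [← h0, ← hk]
    push_cast
    ring
  -- Division by zero gives `q 0 = 0`, which settles nonnegativity at the origin.
  let q : ℝ → ℝ := fun x => (Q 0 x).re / x
  have hqm : Measurable q :=
    (Complex.measurable_re.comp (hQd 0).continuous.measurable).div measurable_id
  have hqp : q =ᵐ[volume] p := by
    filter_upwards [hQae 0, compl_mem_ae_iff.2 (measure_singleton (0 : ℝ))] with x h0 hx
    have hx' : x ≠ 0 := hx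
    simp only [q, ← h0, Complex.ofReal_re]
    field_simp
    ring
  have hqs : ContDiffOn ℝ ∞ q {0}ᶜ := by
    rw [contDiffOn_infty]
    intro k
    have : ContDiffOn ℝ k (fun x : ℝ => (Q k x).re / x ^ (k + 1)) {0}ᶜ := by
      refine ContDiffOn.div ?_ (by fun_prop) fun x hx => pow_ne_zero _ hx
      exact (Complex.reCLM.contDiff.comp (hQd k)).contDiffOn
    refine this.congr fun x hx => ?_
    have hx' : x ≠ 0 := hx
    have h2 : (Q k x).re = x ^ k * (Q 0 x).re := by
      rw [← hQ0 k x, ← Complex.ofReal_pow, Complex.re_ofReal_mul]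
    simp only [q, h2]
    field_simp
    ring
  refine ⟨q, hqm, fun x => ?_, hqp, hqs⟩
  -- A negative value at a point off the origin would persist on a nonempty open set, yet `q = p ≥
  -- 0` almost everywhere.
  by_contra! hneg
  have hx : x ∈ ({0}ᶜ : Set ℝ) := by
    rintro rfl
    simp [q] at hneg
  have hopen : IsOpen ({0}ᶜ ∩ q ⁻¹' Set.Iio 0) :=
    hqs.continuousOn.isOpen_inter_preimage isOpen_compl_singleton isOpen_Iio
  refine (hopen.measure_pos volume ⟨x, hx, hneg⟩).ne' (measure_mono_null ?_ hqp)
  rintro y ⟨-, hy⟩ h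
  have h : q y = p y := h
  have hy : q y < 0 := hy
  linarith [hp0 y]

/-! ### From linear relations between Fourier transforms to pointwise differential equations -/

open Complex in
lemma fourier_pow_mul_eq_iteratedDeriv_charFun {μ : Measure ℝ} [IsFiniteMeasure μ] {p : ℝ → ℝ}
    (hpm : Measurable p) (hp0 : ∀ x, 0 ≤ p x)
    (hμ : μ = volume.withDensity fun x => ENNReal.ofReal (p x)) {k : ℕ} (hk : MemLp id k μ) (ξ : ℝ) :
    𝓕 (fun x : ℝ => ((x ^ k * p x : ℝ) : ℂ)) ξ =
      (-I) ^ k * iteratedDeriv k (charFun μ) (-(2 * Real.pi * ξ)) := by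
  rw [iteratedDeriv_charFun hk, ← mul_assoc, ← mul_pow]
  simp only [neg_mul, I_mul_I, neg_neg, one_pow, one_mul]
  rw [hμ, integral_withDensity_eq_integral_toReal_smul (by fun_prop) (by simp),
    Real.fourier_real_eq_integral_exp_smul]
  congr 1
  ext x
  rw [ENNReal.toReal_ofReal (hp0 x)]
  simp only [smul_eq_mul, real_smul]
  push_cast
  have : (-2 * Real.pi * x * ξ * I : ℂ) = -(2 * Real.pi * ξ) * x * I := by ring
  rw [this]
  ring

lemma integrable_pow_mul_density {μ : Measure ℝ} [IsFiniteMeasure μ] {p : ℝ → ℝ}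
    (hpm : Measurable p) (hp0 : ∀ x, 0 ≤ p x)
    (hμ : μ = volume.withDensity fun x => ENNReal.ofReal (p x)) {k : ℕ} (hk : MemLp id k μ) :
    Integrable (fun x => x ^ k * p x) := by
  have h : Integrable (fun x : ℝ => x ^ k) μ := by
    rcases eq_or_ne k 0 with rfl | h0
    · simp
    · have := hk.integrable_norm_pow h0
      exact this.mono' (by fun_prop) (by simp)
  rw [hμ, integrable_withDensity_iff (by fun_prop) (by simp)] at h
  simpa [ENNReal.toReal_ofReal (hp0 _)] using h

lemma tsupport_iteratedDeriv_subset (φ : ℝ → ℝ) (j : ℕ) :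
    tsupport (iteratedDeriv j φ) ⊆ tsupport φ := by
  induction j with
  | zero => simp
  | succ j ih =>
    rw [iteratedDeriv_succ]
    exact (closure_minimal support_deriv_subset (isClosed_tsupport _)).trans ih

lemma integral_mul_iteratedDeriv_eq {φ : ℝ → ℝ} (hφ : ContDiff ℝ ∞ φ) (hφs : HasCompactSupport φ)
    (j : ℕ) {g : ℝ → ℝ} (hg : ContDiff ℝ j g) :
    ∫ x, g x * iteratedDeriv j φ x = (-1) ^ j * ∫ x, iteratedDeriv j g x * φ x := by
  induction j generalizing g with
  | zero => simp
  | succ j ih =>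
    have hg' : ContDiff ℝ j (deriv g) := by
      have : ContDiff ℝ ((j : WithTop ℕ∞) + 1) g := by exact_mod_cast hg
      exact (contDiff_succ_iff_deriv.1 this).2.2
    have hgd : Differentiable ℝ g := hg.differentiable (by simp)
    have hφj : ∀ i, ContDiff ℝ ∞ (iteratedDeriv i φ) := fun i => by
      rw [iteratedDeriv_eq_iterate]
      exact hφ.iterate_deriv i
    have hs : ∀ i, HasCompactSupport (iteratedDeriv i φ) := fun i =>
      hφs.mono' (subset_closure.trans (tsupport_iteratedDeriv_subset φ i))
    have hd : Differentiable ℝ (iteratedDeriv j φ) := (hφj j).differentiable (by simp)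
    have key := integral_mul_deriv_eq_deriv_mul_of_integrable (u := g) (u' := deriv g)
      (v := iteratedDeriv j φ) (v' := iteratedDeriv (j + 1) φ)
      (fun x _ => (hgd x).hasDerivAt) (fun x _ => by
        rw [iteratedDeriv_succ]; exact (hd x).hasDerivAt)
      ((hg.continuous.mul (hφj _).continuous).integrable_of_hasCompactSupport (hs _).mul_left)
      ((hg'.continuous.mul (hφj _).continuous).integrable_of_hasCompactSupport (hs _).mul_left)
      ((hg.continuous.mul (hφj _).continuous).integrable_of_hasCompactSupport (hs _).mul_left)
    rw [key, ih hg', ← iteratedDeriv_succ', pow_succ]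
    ring

lemma ContDiffAt.exists_contDiff_eventuallyEq {f : ℝ → ℝ} {N : ℕ} {x₀ : ℝ}
    (hf : ContDiffAt ℝ N f x₀) : ∃ g : ℝ → ℝ, ContDiff ℝ N g ∧ g =ᶠ[nhds x₀] f := by
  obtain ⟨r, hr, hrs⟩ := Metric.nhds_basis_closedBall.mem_iff.1 (hf.eventually (by simp))
  let b : ContDiffBump x₀ := ⟨r / 2, r, by positivity, by linarith⟩
  refine ⟨fun x => b x * f x, contDiff_iff_contDiffAt.2 fun y => ?_, ?_⟩
  · by_cases hy : y ∈ Metric.closedBall x₀ r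
    · exact b.contDiff.contDiffAt.mul (hrs hy)
    · have h0 : (b : ℝ → ℝ) =ᶠ[nhds y] 0 := by
        rw [← notMem_tsupport_iff_eventuallyEq, b.tsupport_eq]
        exact hy
      have : (fun x => b x * f x) =ᶠ[nhds y] fun _ => 0 := by
        filter_upwards [h0] with x hx
        simp [hx]
      exact contDiffAt_const.congr_of_eventuallyEq this
  · filter_upwards [b.eventuallyEq_one] with x hx
    simp [hx]

/-- Expresses the `j`-th distributional derivative of a merely integrable `f` on the Fourier side:
`φ = 𝓕 h` makes its `j`-th derivative the transform of `(-2πIξ)^j h`, and the transform then moves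
onto `f`. -/
lemma integral_mul_iteratedDeriv_eq_fourier {f φ : ℝ → ℝ} (hf : Integrable f)
    (hφ : ContDiff ℝ ∞ φ) {h : SchwartzMap ℝ ℂ} (hh : 𝓕 (h : ℝ → ℂ) = fun x => (φ x : ℂ)) (j : ℕ) :
    ((∫ x, f x * iteratedDeriv j φ x : ℝ) : ℂ) =
        ∫ ξ, 𝓕 (fun x => (f x : ℂ)) ξ * ((-2 * Real.pi * Complex.I * ξ) ^ j * h ξ) ∧
      Integrable (fun ξ : ℝ => 𝓕 (fun x => (f x : ℂ)) ξ * ((-2 * Real.pi * Complex.I * ξ) ^ j * h ξ)) := by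
  have hi : ∀ n : ℕ, Integrable (fun x : ℝ => x ^ n • h x) := fun n => by
    have := h.integrable_pow_mul volume n
    refine this.mono (by fun_prop) (ae_of_all _ fun x => ?_)
    simp
  have hj : Integrable (fun ξ : ℝ => (-2 * Real.pi * Complex.I * ξ) ^ j * h ξ) := by
    have := (hi j).const_mul ((-2 * Real.pi * Complex.I) ^ j)
    refine this.congr (ae_of_all _ fun x => ?_)
    simp
    ring
  have e : ∀ x, ((iteratedDeriv j φ x : ℝ) : ℂ) =
      𝓕 (fun ξ : ℝ => (-2 * Real.pi * Complex.I * ξ) ^ j * h ξ) x := by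
    intro x
    have h1 := Real.iteratedDeriv_fourier (f := (h : ℝ → ℂ)) (N := ⊤) (n := j) (fun n _ => hi n) le_top
    simp only [smul_eq_mul] at h1
    rw [← h1, hh]
    have := Complex.ofRealCLM.iteratedFDeriv_comp_left (f := φ) (x := x) (n := ∞) (i := j)
      hφ.contDiffAt (by exact_mod_cast le_top)
    rw [iteratedDeriv_eq_iteratedFDeriv, iteratedDeriv_eq_iteratedFDeriv]
    exact (congrArg (fun m => m fun _ => (1 : ℝ)) this).symm
  constructor
  · rw [← integral_complex_ofReal]
    push_cast
    simp_rw [e]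
    have := integral_fourier_smul_eq_flip hf.ofReal hj
    simp only [smul_eq_mul] at this
    exact this.symm
  · have hc : Continuous (𝓕 (fun x => (f x : ℂ))) :=
      VectorFourier.fourierIntegral_continuous Real.continuous_fourierChar
        (by exact continuous_inner) hf.ofReal
    refine hj.bdd_mul (c := ∫ x, ‖(f x : ℂ)‖) hc.aestronglyMeasurable (ae_of_all _ fun ξ => ?_)
    exact VectorFourier.norm_fourierIntegral_le_integral_norm _ _ _ _ _

/-- A linear relation between the Fourier transforms of two integrable functions, with polynomial
coefficients, gives a differential equation at every point where the functions are smooth enough. -/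
theorem sum_iteratedDeriv_eq_zero_of_fourier {N : ℕ} {a b : ℕ → ℝ} {f g : ℝ → ℝ}
    (hf : Integrable f) (hg : Integrable g)
    (h : ∀ ξ : ℝ, ∑ j ∈ Finset.range (N + 1), (-2 * Real.pi * Complex.I * ξ) ^ j *
      (a j * 𝓕 (fun x => (f x : ℂ)) ξ + b j * 𝓕 (fun x => (g x : ℂ)) ξ) = 0)
    {x₀ : ℝ} (hf' : ContDiffAt ℝ N f x₀) (hg' : ContDiffAt ℝ N g x₀) :
    ∑ j ∈ Finset.range (N + 1),
      (-1) ^ j * (a j * iteratedDeriv j f x₀ + b j * iteratedDeriv j g x₀) = 0 := by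
  -- `f` and `g` are smooth only near `x₀`; globally `C^N` functions agreeing with them on an open
  -- `U` allow integration by parts against test functions supported in `U`.
  obtain ⟨u, hu, huf⟩ := hf'.exists_contDiff_eventuallyEq
  obtain ⟨w, hw, hwg⟩ := hg'.exists_contDiff_eventuallyEq
  obtain ⟨U, hUs, hU, hxU⟩ := eventually_nhds_iff.1 (huf.and hwg)
  let D : ℝ → ℝ := fun x => ∑ j ∈ Finset.range (N + 1),
      (-1) ^ j * (a j * iteratedDeriv j u x + b j * iteratedDeriv j w x)
  have hcu : ∀ j ∈ Finset.range (N + 1), Continuous (iteratedDeriv j u) := fun j hj =>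
    hu.continuous_iteratedDeriv j (by exact_mod_cast Finset.mem_range_succ_iff.1 hj)
  have hcw : ∀ j ∈ Finset.range (N + 1), Continuous (iteratedDeriv j w) := fun j hj =>
    hw.continuous_iteratedDeriv j (by exact_mod_cast Finset.mem_range_succ_iff.1 hj)
  have hD : Continuous D := by
    refine continuous_finsetSum _ fun j hj => ?_
    have := hcu j hj
    have := hcw j hj
    fun_prop
  have hweak : ∀ φ : ℝ → ℝ, ContDiff ℝ ∞ φ → HasCompactSupport φ → tsupport φ ⊆ U →
      ∫ x, φ x • D x = 0 := by
    intro φ hφ hφs hφU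
    obtain ⟨s, hs, -⟩ := exists_schwartz_fourier_eq hφ hφs
    have hloc : ∀ {v k : ℝ → ℝ}, (∀ y ∈ U, v y = k y) → ∀ j,
        ∫ x, k x * iteratedDeriv j φ x = ∫ x, v x * iteratedDeriv j φ x := by
      intro v k hvk j
      congr 1
      ext x
      by_cases hx : x ∈ U
      · rw [hvk x hx]
      · rw [image_eq_zero_of_notMem_tsupport
          fun hx' => hx (hφU (tsupport_iteratedDeriv_subset φ j hx'))]
        simp
    have h1 : ∑ j ∈ Finset.range (N + 1), (a j * ∫ x, f x * iteratedDeriv j φ x) +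
        ∑ j ∈ Finset.range (N + 1), (b j * ∫ x, g x * iteratedDeriv j φ x) = 0 := by
      apply Complex.ofReal_injective
      rw [Complex.ofReal_add, Complex.ofReal_sum, Complex.ofReal_sum, Complex.ofReal_zero]
      simp_rw [Complex.ofReal_mul, fun j => (integral_mul_iteratedDeriv_eq_fourier hf hφ hs j).1,
        fun j => (integral_mul_iteratedDeriv_eq_fourier hg hφ hs j).1, ← integral_const_mul]
      rw [← integral_finsetSum _ fun j _ =>
          (integral_mul_iteratedDeriv_eq_fourier hf hφ hs j).2.const_mul _,
        ← integral_finsetSum _ fun j _ =>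
          (integral_mul_iteratedDeriv_eq_fourier hg hφ hs j).2.const_mul _,
        ← integral_add
          (integrable_finsetSum _ fun j _ =>
            (integral_mul_iteratedDeriv_eq_fourier hf hφ hs j).2.const_mul _)
          (integrable_finsetSum _ fun j _ =>
            (integral_mul_iteratedDeriv_eq_fourier hg hφ hs j).2.const_mul _)]
      rw [← integral_zero ℝ ℂ]
      congr 1
      ext ξ
      rw [← Finset.sum_add_distrib]
      calc _ = (∑ j ∈ Finset.range (N + 1), (-2 * Real.pi * Complex.I * ξ) ^ j *
            (a j * 𝓕 (fun x => (f x : ℂ)) ξ + b j * 𝓕 (fun x => (g x : ℂ)) ξ)) * s ξ := by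
            rw [Finset.sum_mul]
            exact Finset.sum_congr rfl fun j _ => by ring
        _ = 0 := by rw [h ξ, zero_mul]
    have hint : ∀ {k : ℝ → ℝ}, Continuous k → Integrable fun x => k x * φ x := fun hk =>
      (hk.mul hφ.continuous).integrable_of_hasCompactSupport hφs.mul_left
    rw [← h1, ← Finset.sum_add_distrib]
    have h2 : ∀ x, φ x • D x = ∑ j ∈ Finset.range (N + 1),
        ((-1) ^ j * a j * (iteratedDeriv j u x * φ x) +
          (-1) ^ j * b j * (iteratedDeriv j w x * φ x)) := by
      intro x
      simp only [D, smul_eq_mul, Finset.mul_sum]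
      exact Finset.sum_congr rfl fun j _ => by ring
    simp_rw [h2]
    have h3 : ∀ j ∈ Finset.range (N + 1), Integrable fun x =>
        (-1) ^ j * a j * (iteratedDeriv j u x * φ x) +
          (-1) ^ j * b j * (iteratedDeriv j w x * φ x) := fun j hj =>
      ((hint (hcu j hj)).const_mul _).add ((hint (hcw j hj)).const_mul _)
    rw [integral_finsetSum _ h3]
    refine Finset.sum_congr rfl fun j hj => ?_
    have hjN : ((j : ℕ) : WithTop ℕ∞) ≤ N := by exact_mod_cast Finset.mem_range_succ_iff.1 hj
    rw [integral_add ((hint (hcu j hj)).const_mul _) ((hint (hcw j hj)).const_mul _),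
      integral_const_mul, integral_const_mul, hloc (fun y hy => (hUs y hy).1) j,
      hloc (fun y hy => (hUs y hy).2) j,
      integral_mul_iteratedDeriv_eq hφ hφs j (hu.of_le hjN),
      integral_mul_iteratedDeriv_eq hφ hφs j (hw.of_le hjN)]
    ring
  have hae := hU.ae_eq_zero_of_integral_contDiff_smul_eq_zero
    (hD.locallyIntegrable.locallyIntegrableOn U) hweak
  -- `D` is continuous and vanishes almost everywhere on `U`, hence everywhere on it.
  have hD0 : D x₀ = 0 := by
    by_contra hne
    have hopen : IsOpen (U ∩ D ⁻¹' {0}ᶜ) := hU.inter (isOpen_compl_singleton.preimage hD)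
    refine (hopen.measure_pos volume ⟨x₀, hxU, hne⟩).ne' (measure_mono_null ?_ hae)
    rintro y ⟨hyU, hy⟩ h
    exact hy (h hyU)
  rw [← hD0]
  refine Finset.sum_congr rfl fun j _ => ?_
  rw [huf.iteratedDeriv_eq, hwg.iteratedDeriv_eq]

/-! ### Decay of derivatives through a graded polynomial calculus -/

/-- `PolyDecay u v k f`: the function `f` is a polynomial in `u` and `v` all of whose monomials have
degree at least `k`. -/
inductive PolyDecay (u v : ℝ → ℂ) : ℕ → (ℝ → ℂ) → Prop
  | const (c : ℂ) : PolyDecay u v 0 (fun _ => c)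
  | left : PolyDecay u v 1 u
  | right : PolyDecay u v 1 v
  | add {k : ℕ} {f g : ℝ → ℂ} (hf : PolyDecay u v k f) (hg : PolyDecay u v k g) :
      PolyDecay u v k (fun t => f t + g t)
  | mul {k l : ℕ} {f g : ℝ → ℂ} (hf : PolyDecay u v k f) (hg : PolyDecay u v l g) :
      PolyDecay u v (k + l) (fun t => f t * g t)
  | weaken {k : ℕ} {f : ℝ → ℂ} (hf : PolyDecay u v (k + 1) f) : PolyDecay u v k f

namespace PolyDecay

variable {u v : ℝ → ℂ}

lemma const_mul (c : ℂ) {k : ℕ} {f : ℝ → ℂ} (hf : PolyDecay u v k f) :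
    PolyDecay u v k (fun t => c * f t) := by
  simpa using (const c).mul hf

/-- Since `u' = cu²` and `v' = dv²`, differentiating a monomial raises its degree by one. -/
lemma exists_hasDerivAt {c d : ℂ} (hu : ∀ t, HasDerivAt u (c * (u t * u t)) t)
    (hv : ∀ t, HasDerivAt v (d * (v t * v t)) t) {k : ℕ} {f : ℝ → ℂ} (hf : PolyDecay u v k f) :
    ∃ g, PolyDecay u v (k + 1) g ∧ ∀ t, HasDerivAt f (g t) t := by
  induction hf with
  | const c => exact ⟨fun t => 0 * u t, left.const_mul 0, fun t => by
      simpa using hasDerivAt_const t c⟩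
  | left => exact ⟨_, (left.mul left).const_mul c, hu⟩
  | right => exact ⟨_, (right.mul right).const_mul d, hv⟩
  | add hf hg ihf ihg =>
    obtain ⟨f', hf', hfd⟩ := ihf
    obtain ⟨g', hg', hgd⟩ := ihg
    exact ⟨_, hf'.add hg', fun t => (hfd t).fun_add (hgd t)⟩
  | @mul k l f g hf hg ihf ihg =>
    obtain ⟨f', hf', hfd⟩ := ihf
    obtain ⟨g', hg', hgd⟩ := ihg
    refine ⟨_, PolyDecay.add (k := k + l + 1) ?_ ?_, fun t => (hfd t).fun_mul (hgd t)⟩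
    · have := hf'.mul hg
      rwa [add_right_comm] at this
    · exact hf.mul hg'
  | weaken hf ih =>
    obtain ⟨f', hf', hfd⟩ := ih
    exact ⟨f', hf'.weaken, hfd⟩

lemma exists_norm_le {C : ℝ} (hu : ∀ t, ‖u t‖ ≤ C / (1 + |t|)) (hv : ∀ t, ‖v t‖ ≤ C / (1 + |t|))
    {k : ℕ} {f : ℝ → ℂ} (hf : PolyDecay u v k f) :
    ∃ B, ∀ t, ‖f t‖ ≤ B / (1 + |t|) ^ k := by
  induction hf with
  | const c => exact ⟨‖c‖, fun t => by simp⟩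
  | left => exact ⟨C, fun t => by simpa using hu t⟩
  | right => exact ⟨C, fun t => by simpa using hv t⟩
  | add hf hg ihf ihg =>
    obtain ⟨B, hB⟩ := ihf
    obtain ⟨D, hD⟩ := ihg
    refine ⟨B + D, fun t => (norm_add_le _ _).trans ?_⟩
    rw [add_div]
    exact add_le_add (hB t) (hD t)
  | mul hf hg ihf ihg =>
    obtain ⟨B, hB⟩ := ihf
    obtain ⟨D, hD⟩ := ihg
    refine ⟨B * D, fun t => ?_⟩
    rw [norm_mul, pow_add, ← div_mul_div_comm]
    exact mul_le_mul (hB t) (hD t) (norm_nonneg _) ((norm_nonneg _).trans (hB t))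
  | weaken hf ih =>
    obtain ⟨B, hB⟩ := ih
    refine ⟨B, fun t => (hB t).trans ?_⟩
    have hB0 : 0 ≤ B := by
      have := (norm_nonneg _).trans (hB 0)
      simpa using this
    gcongr
    · linarith [abs_nonneg t]
    · omega

/-- Decay of all derivatives of a function whose logarithmic derivative is a polynomial without
constant term in `u` and `v`. -/
theorem exists_norm_iteratedDeriv_le {c d : ℂ} {C : ℝ}
    (hu : ∀ t, HasDerivAt u (c * (u t * u t)) t) (hv : ∀ t, HasDerivAt v (d * (v t * v t)) t)
    (hun : ∀ t, ‖u t‖ ≤ C / (1 + |t|)) (hvn : ∀ t, ‖v t‖ ≤ C / (1 + |t|))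
    {φ r : ℝ → ℂ} (hr : PolyDecay u v 1 r) (hφ : ∀ t, HasDerivAt φ (φ t * r t) t) {B : ℝ}
    (hφn : ∀ t, ‖φ t‖ ≤ B / (1 + |t|)) (k : ℕ) :
    ∃ D, ∀ t, ‖iteratedDeriv k φ t‖ ≤ D / (1 + |t|) ^ (k + 1) := by
  -- The cofactor evolves by `g ↦ rg + g'`, and both terms gain a degree. The extra power in the
  -- final bound comes from `φ`.
  have key : ∃ g, PolyDecay u v k g ∧ ∀ t, iteratedDeriv k φ t = φ t * g t := by
    induction k with
    | zero => exact ⟨_, const 1, fun t => by simp⟩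
    | succ k ih =>
      obtain ⟨g, hg, hgk⟩ := ih
      obtain ⟨g', hg', hgd⟩ := hg.exists_hasDerivAt hu hv
      refine ⟨_, (add_comm 1 k ▸ hr.mul hg).add hg', fun t => ?_⟩
      rw [iteratedDeriv_succ, funext hgk, ((hφ t).fun_mul (hgd t)).deriv]
      ring
  obtain ⟨g, hg, hgk⟩ := key
  obtain ⟨D, hD⟩ := hg.exists_norm_le hun hvn
  refine ⟨B * D, fun t => ?_⟩
  rw [hgk, norm_mul, pow_succ', ← div_mul_div_comm]
  exact mul_le_mul (hφn t) (hD t) (norm_nonneg _) ((norm_nonneg _).trans (hφn t))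

end PolyDecay

/-! ### The factors of the characteristic function -/

section QuadraticFactor

open Complex

lemma one_add_mul_I_ne_zero (c t : ℝ) : (1 + c * (I * t) : ℂ) ≠ 0 := fun h => by
  simpa using congrArg re h

lemma hasDerivAt_one_add_mul_I (c t : ℝ) :
    HasDerivAt (fun t : ℝ => (1 + c * (I * t) : ℂ)) (c * I) t := by
  have := (((hasDerivAt_id t).ofReal_comp.const_mul I).const_mul (c : ℂ)).const_add 1
  simpa using this

lemma exists_norm_inv_one_add_mul_I_le {c : ℝ} (hc : c ≠ 0) :
    ∃ C, ∀ t : ℝ, ‖((1 + c * (I * t))⁻¹ : ℂ)‖ ≤ C / (1 + |t|) := by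
  refine ⟨1 + |c|⁻¹, fun t => ?_⟩
  have hc' : 0 < |c| := abs_pos.2 hc
  have h1 : 1 ≤ ‖(1 + c * (I * t) : ℂ)‖ := by
    simpa using abs_re_le_norm (1 + c * (I * t) : ℂ)
  have h2 : |c| * |t| ≤ ‖(1 + c * (I * t) : ℂ)‖ := by
    simpa [abs_mul] using abs_im_le_norm (1 + c * (I * t) : ℂ)
  rw [norm_inv, inv_eq_one_div, div_le_div_iff₀ (by linarith) (by positivity), one_mul, add_mul, one_mul]
  have h3 : |t| ≤ |c|⁻¹ * ‖(1 + c * (I * t) : ℂ)‖ := by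
    rw [inv_mul_eq_div, le_div_iff₀ hc']
    linarith
  linarith

lemma hasDerivAt_inv_one_add_mul_I (c t : ℝ) :
    HasDerivAt (fun t : ℝ => ((1 + c * (I * t))⁻¹ : ℂ))
      (-(c * I) * ((1 + c * (I * t))⁻¹ * (1 + c * (I * t))⁻¹)) t := by
  refine ((hasDerivAt_one_add_mul_I c t).fun_inv (one_add_mul_I_ne_zero c t)).congr_deriv ?_
  rw [← mul_inv, ← pow_two, div_eq_mul_inv]

/-- The characteristic function of the square of a normal variable, up to the sign of the argument,
with `c` and `a` determined by the variance and the mean. -/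
noncomputable def quadraticFactor (a c t : ℝ) : ℂ :=
  (1 + c * (I * t)) ^ (-(1 / 2) : ℂ) * exp (a * (I * t) / (1 + c * (I * t)))

lemma hasDerivAt_quadraticFactor (a c t : ℝ) :
    HasDerivAt (quadraticFactor a c)
      (quadraticFactor a c t * (I * (-(c / 2) * (1 + c * (I * t))⁻¹ +
        a * ((1 + c * (I * t))⁻¹ * (1 + c * (I * t))⁻¹)))) t := by
  have hz := one_add_mul_I_ne_zero c t
  have hs : (1 + c * (I * t) : ℂ) ∈ slitPlane := by
    left; simp
  have h1 := ((hasDerivAt_id (1 + c * (I * t) : ℂ)).cpow_const (c := (-(1 / 2) : ℂ)) hs).scomp t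
    (hasDerivAt_one_add_mul_I c t)
  have h2 : HasDerivAt (fun t : ℝ => (a * (I * t) : ℂ)) (a * I) t := by
    simpa using ((hasDerivAt_id t).ofReal_comp.const_mul I).const_mul (a : ℂ)
  have h3 := (h2.fun_div (hasDerivAt_one_add_mul_I c t) hz).cexp
  refine (h1.fun_mul h3).congr_deriv ?_
  simp only [quadraticFactor, id, Function.comp, smul_eq_mul]
  rw [cpow_sub _ _ hz, cpow_one]
  field_simp
  ring

/-- Squaring removes the half power, and the exponential has modulus at most 1 because its exponent
has real part `act² / (1 + c²t²) ≤ 0`. -/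
lemma norm_quadraticFactor_sq_le {a c : ℝ} (hac : a * c ≤ 0) (t : ℝ) :
    ‖quadraticFactor a c t‖ ^ 2 ≤ ‖((1 + c * (I * t))⁻¹ : ℂ)‖ := by
  have hz := one_add_mul_I_ne_zero c t
  have h1 : ((1 + c * (I * t)) ^ (-(1 / 2) : ℂ)) ^ 2 = ((1 + c * (I * t))⁻¹ : ℂ) := by
    rw [← cpow_nat_mul]
    norm_num [cpow_neg_one]
  have h2 : ‖cexp (a * (I * t) / (1 + c * (I * t)))‖ ≤ 1 := by
    rw [norm_exp, Real.exp_le_one_iff]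
    have : (a * (I * t) / (1 + c * (I * t)) : ℂ).re = a * c * t ^ 2 / (1 + c ^ 2 * t ^ 2) := by
      rw [div_re]
      simp [normSq_apply]
      ring
    rw [this]
    exact div_nonpos_of_nonpos_of_nonneg (mul_nonpos_of_nonpos_of_nonneg hac (sq_nonneg t))
      (by positivity)
  rw [quadraticFactor, norm_mul, mul_pow, ← norm_pow, h1]
  exact mul_le_of_le_one_right (norm_nonneg _) (pow_le_one₀ (norm_nonneg _) h2)

lemma charFun_productNormal_eq_quadraticFactor_mul (μX μY : ℝ) {ρ : ℝ}
    (hρ : ρ ∈ Set.Ioo (-1 : ℝ) 1) (t : ℝ) :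
    charFun (productNormal μX μY 1 1 ρ) t =
      quadraticFactor (((μX + μY) / 2) ^ 2) (-(1 + ρ)) t *
        quadraticFactor (-((μX - μY) / 2) ^ 2) (1 - ρ) t := by
  rw [charFun_productNormal_one_one μX μY hρ, quadraticFactor, quadraticFactor]
  push_cast
  simp only [neg_mul, sub_eq_add_neg]

end QuadraticFactor

/-! ### The mean of `n` copies -/

section Mean

open Complex

/-- The logarithmic derivative, divided by `I`, of the characteristic function of the mean of `n`
independent product normal variables. -/
noncomputable def meanLogDeriv (μX μY ρ : ℝ) (n : ℕ) (t : ℝ) : ℂ :=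
  (1 + ρ) / 2 * (1 + ((-(1 + ρ) / n : ℝ) : ℂ) * (I * t))⁻¹ +
    ((μX + μY) / 2) ^ 2 * ((1 + ((-(1 + ρ) / n : ℝ) : ℂ) * (I * t))⁻¹ *
      (1 + ((-(1 + ρ) / n : ℝ) : ℂ) * (I * t))⁻¹) +
    (-((1 - ρ) / 2) * (1 + (((1 - ρ) / n : ℝ) : ℂ) * (I * t))⁻¹ +
      -((μX - μY) / 2) ^ 2 * ((1 + (((1 - ρ) / n : ℝ) : ℂ) * (I * t))⁻¹ *
        (1 + (((1 - ρ) / n : ℝ) : ℂ) * (I * t))⁻¹))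

lemma hasDerivAt_charFun_productNormal_pow (μX μY : ℝ) {ρ : ℝ} (hρ : ρ ∈ Set.Ioo (-1 : ℝ) 1)
    {n : ℕ} (hn : 1 ≤ n) (t : ℝ) :
    HasDerivAt (fun t : ℝ => charFun (productNormal μX μY 1 1 ρ) ((n : ℝ)⁻¹ * t) ^ n)
      (charFun (productNormal μX μY 1 1 ρ) ((n : ℝ)⁻¹ * t) ^ n *
        (I * meanLogDeriv μX μY ρ n t)) t := by
  have hn0 : (n : ℂ) ≠ 0 := by exact_mod_cast (by omega : n ≠ 0)
  have h1 := (hasDerivAt_quadraticFactor (((μX + μY) / 2) ^ 2) (-(1 + ρ)) ((n : ℝ)⁻¹ * t)).fun_mul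
    (hasDerivAt_quadraticFactor (-((μX - μY) / 2) ^ 2) (1 - ρ) ((n : ℝ)⁻¹ * t))
  have hψ : charFun (productNormal μX μY 1 1 ρ) = _ :=
    funext (charFun_productNormal_eq_quadraticFactor_mul μX μY hρ)
  rw [← hψ] at h1
  have h2 : HasDerivAt (fun t : ℝ => (n : ℝ)⁻¹ * t) (n : ℝ)⁻¹ t := by
    simpa using (hasDerivAt_id t).const_mul (n : ℝ)⁻¹
  have h3 := (h1.scomp t h2).fun_pow n
  refine h3.congr_deriv ?_
  obtain ⟨m, rfl⟩ : ∃ m, n = m + 1 := ⟨n - 1, by omega⟩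
  have e1 : (1 + ((-(1 + ρ) / (m + 1 : ℕ) : ℝ) : ℂ) * (I * t)) =
      1 + ((-(1 + ρ) : ℝ) : ℂ) * (I * (((m + 1 : ℕ) : ℝ)⁻¹ * t : ℝ)) := by
    push_cast; ring
  have e2 : (1 + (((1 - ρ) / (m + 1 : ℕ) : ℝ) : ℂ) * (I * t)) =
      1 + ((1 - ρ : ℝ) : ℂ) * (I * (((m + 1 : ℕ) : ℝ)⁻¹ * t : ℝ)) := by
    push_cast; ring
  simp only [Function.comp, meanLogDeriv, e1, e2, Nat.add_sub_cancel, real_smul]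
  rw [charFun_productNormal_eq_quadraticFactor_mul μX μY hρ]
  have hm : ((((m + 1 : ℕ) : ℝ)⁻¹ : ℝ) : ℂ) = ((m + 1 : ℕ) : ℂ)⁻¹ := by push_cast; rfl
  rw [hm]
  generalize (1 + ((-(1 + ρ) : ℝ) : ℂ) * (I * (((m + 1 : ℕ) : ℝ)⁻¹ * t : ℝ)))⁻¹ = U
  generalize (1 + ((1 - ρ : ℝ) : ℂ) * (I * (((m + 1 : ℕ) : ℝ)⁻¹ * t : ℝ)))⁻¹ = V
  generalize quadraticFactor _ _ _ = G
  generalize quadraticFactor _ _ _ = H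
  rw [pow_succ]
  push_cast at hn0 ⊢
  field_simp
  ring

/-- Each of the two factors decays like `|t|^(-1/2)`, so one copy already gives `1/|t|`; the
remaining copies have modulus at most 1. -/
lemma exists_norm_charFun_productNormal_pow_le (μX μY : ℝ) {ρ : ℝ} (hρ : ρ ∈ Set.Ioo (-1 : ℝ) 1)
    {n : ℕ} (hn : 1 ≤ n) :
    ∃ B, ∀ t : ℝ, ‖charFun (productNormal μX μY 1 1 ρ) ((n : ℝ)⁻¹ * t) ^ n‖ ≤ B / (1 + |t|) := by
  have hn0 : (1 : ℝ) ≤ n := by exact_mod_cast hn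
  have hc1 : -(1 + ρ) ≠ 0 := by linarith [hρ.1]
  have hc2 : 1 - ρ ≠ 0 := by linarith [hρ.2]
  obtain ⟨C, hC⟩ := exists_norm_inv_one_add_mul_I_le hc1
  obtain ⟨D, hD⟩ := exists_norm_inv_one_add_mul_I_le hc2
  have hC0 : 0 ≤ C := by
    have := (norm_nonneg _).trans (hC 0)
    simpa using this
  have hD0 : 0 ≤ D := by
    have := (norm_nonneg _).trans (hD 0)
    simpa using this
  have h1 : ∀ s : ℝ, ‖charFun (productNormal μX μY 1 1 ρ) s‖ ≤ (C + D) / (1 + |s|) := by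
    intro s
    refine abs_le_of_sq_le_sq' ?_ (by positivity) |>.2
    rw [charFun_productNormal_eq_quadraticFactor_mul μX μY hρ, norm_mul, mul_pow]
    have hp : 0 < 1 + |s| := by positivity
    calc _ ≤ (C / (1 + |s|)) * (D / (1 + |s|)) := by
          refine mul_le_mul ((norm_quadraticFactor_sq_le ?_ s).trans (hC s))
            ((norm_quadraticFactor_sq_le ?_ s).trans (hD s)) (by positivity) (by positivity)
          · nlinarith [hρ.1, sq_nonneg ((μX + μY) / 2)]
          · nlinarith [hρ.2, sq_nonneg ((μX - μY) / 2)]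
      _ ≤ _ := by
          rw [div_mul_div_comm, div_pow, ← pow_two]
          gcongr
          nlinarith
  refine ⟨(C + D) * n, fun t => ?_⟩
  rw [norm_pow]
  calc _ ≤ ‖charFun (productNormal μX μY 1 1 ρ) ((n : ℝ)⁻¹ * t)‖ :=
        pow_le_of_le_one (norm_nonneg _) (norm_charFun_le_one _) (by omega)
    _ ≤ _ := h1 _
    _ ≤ _ := by
        rw [abs_mul, abs_inv, Nat.abs_cast, div_le_div_iff₀ (by positivity) (by positivity)]
        have : (C + D) * n * (1 + (n : ℝ)⁻¹ * |t|) = (C + D) * (n + |t|) := by field_simp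
        rw [this]
        gcongr

lemma exists_norm_iteratedDeriv_charFun_productNormal_pow_le (μX μY : ℝ) {ρ : ℝ}
    (hρ : ρ ∈ Set.Ioo (-1 : ℝ) 1) {n : ℕ} (hn : 1 ≤ n) (k : ℕ) :
    ∃ D, ∀ t : ℝ, ‖iteratedDeriv k
      (fun t : ℝ => charFun (productNormal μX μY 1 1 ρ) ((n : ℝ)⁻¹ * t) ^ n) t‖ ≤
        D / (1 + |t|) ^ (k + 1) := by
  have hn0 : (n : ℝ) ≠ 0 := by exact_mod_cast (by omega : n ≠ 0)
  have hc1 : -(1 + ρ) / n ≠ 0 := div_ne_zero (by linarith [hρ.1]) hn0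
  have hc2 : (1 - ρ) / n ≠ 0 := div_ne_zero (by linarith [hρ.2]) hn0
  obtain ⟨C, hC⟩ := exists_norm_inv_one_add_mul_I_le hc1
  obtain ⟨D, hD⟩ := exists_norm_inv_one_add_mul_I_le hc2
  obtain ⟨B, hB⟩ := exists_norm_charFun_productNormal_pow_le μX μY hρ hn
  refine PolyDecay.exists_norm_iteratedDeriv_le (C := max C D)
    (hasDerivAt_inv_one_add_mul_I (-(1 + ρ) / n)) (hasDerivAt_inv_one_add_mul_I ((1 - ρ) / n))
    (fun t => (hC t).trans ?_) (fun t => (hD t).trans ?_) ?_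
    (hasDerivAt_charFun_productNormal_pow μX μY hρ hn) hB k
  · gcongr; exact le_max_left _ _
  · gcongr; exact le_max_right _ _
  · refine PolyDecay.const_mul I (PolyDecay.add (PolyDecay.add ?_ ?_) (PolyDecay.add ?_ ?_))
    · exact PolyDecay.left.const_mul _
    · exact ((PolyDecay.left.mul PolyDecay.left).weaken).const_mul _
    · exact PolyDecay.right.const_mul _
    · exact ((PolyDecay.right.mul PolyDecay.right).weaken).const_mul _

lemma charFun_map_mean {Ω : Type*} [MeasurableSpace Ω] {P : Measure Ω}
    {μX μY ρ : ℝ} {n : ℕ} {Z : Fin n → Ω → ℝ}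
    (hlaw : ∀ i, HasLaw (Z i) (productNormal μX μY 1 1 ρ) P)
    (hindep : iIndepFun Z P) :
    charFun (P.map fun w => (n : ℝ)⁻¹ * ∑ i, Z i w) =
      fun t : ℝ => charFun (productNormal μX μY 1 1 ρ) ((n : ℝ)⁻¹ * t) ^ n := by
  have hm : AEMeasurable (fun w => ∑ i, Z i w) P :=
    Finset.aemeasurable_fun_sum _ fun i _ => (hlaw i).aemeasurable
  ext t
  rw [charFun_map_mul_comp hm,
    hindep.charFun_map_fun_sum_eq_prod fun i => (hlaw i).aemeasurable]
  simp [fun i => (hlaw i).map_eq]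

lemma memLp_id_map_mean {Ω : Type*} [MeasurableSpace Ω] {P : Measure Ω}
    {μX μY ρ : ℝ} {n : ℕ} {Z : Fin n → Ω → ℝ}
    (hρ : ρ ∈ Set.Ioo (-1 : ℝ) 1)
    (hlaw : ∀ i, HasLaw (Z i) (productNormal μX μY 1 1 ρ) P) (k : ℕ) :
    MemLp id k (P.map fun w => (n : ℝ)⁻¹ * ∑ i, Z i w) := by
  have hm : AEMeasurable (fun w => ∑ i, Z i w) P :=
    Finset.aemeasurable_fun_sum _ fun i _ => (hlaw i).aemeasurable
  have hs : MemLp (fun w => ∑ i, Z i w) k P := by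
    refine memLp_finsetSum _ fun i _ => ?_
    have h := memLp_id_productNormal_one_one μX μY hρ k
    rw [← (hlaw i).map_eq] at h
    exact h.comp_of_map (hlaw i).aemeasurable
  have h2 := hs.const_mul (n : ℝ)⁻¹
  rw [memLp_map_measure_iff (by fun_prop) (hm.const_mul _)]
  exact h2

lemma map_mean_absolutelyContinuous {Ω : Type*} [MeasurableSpace Ω] {P : Measure Ω} [IsProbabilityMeasure P]
    {μX μY ρ : ℝ} {n : ℕ} {Z : Fin n → Ω → ℝ}
    (hρ : ρ ∈ Set.Ioo (-1 : ℝ) 1) (hn : 1 ≤ n)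
    (hlaw : ∀ i, HasLaw (Z i) (productNormal μX μY 1 1 ρ) P) (hindep : iIndepFun Z P) :
    (P.map fun w => (n : ℝ)⁻¹ * ∑ i, Z i w) ≪ volume := by
  have hn0 : (n : ℝ)⁻¹ ≠ 0 := inv_ne_zero (by exact_mod_cast (by omega : n ≠ 0))
  have hZ : ∀ i, AEMeasurable (Z i) P := fun i => (hlaw i).aemeasurable
  have hm : AEMeasurable (fun w => ∑ i, Z i w) P := Finset.aemeasurable_fun_sum _ fun i _ => hZ i
  have h1 : (P.map fun w => ∑ i, Z i w) ≪ volume := by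
    -- One absolutely continuous summand, independent of the sum of the others, is enough.
    let i₀ : Fin n := ⟨0, hn⟩
    have hi := hindep.indepFun_finsetSum_of_notMem₀ hZ (Finset.notMem_erase i₀ Finset.univ)
    have hs : (fun w => ∑ i, Z i w) = (∑ j ∈ Finset.univ.erase i₀, Z j) + Z i₀ := by
      ext w
      simp [Finset.sum_apply]
    rw [hs, hi.map_add_eq_map_conv_map₀ (Finset.aemeasurable_sum _ fun i _ => hZ i) (hZ i₀),
      (hlaw i₀).map_eq]
    exact Measure.conv_absolutelyContinuous (productNormal_one_one_absolutelyContinuous μX μY hρ)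
  have h2 : (P.map fun w => (n : ℝ)⁻¹ * ∑ i, Z i w) =
      (P.map fun w => ∑ i, Z i w).map (fun x => (n : ℝ)⁻¹ * x) := by
    rw [AEMeasurable.map_map_of_aemeasurable (by fun_prop) hm]
    rfl
  rw [h2]
  refine (h1.map (by fun_prop)).trans ?_
  rw [Real.map_volume_mul_left hn0]
  exact Measure.smul_absolutelyContinuous

end Mean

/-! ### The polynomial relation and the differential equation -/

lemma iteratedDeriv_succ_id_mul {p : ℝ → ℝ} {j : ℕ} {x : ℝ} (hp : ContDiffAt ℝ (j + 1 : ℕ) p x) :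
    iteratedDeriv (j + 1) (fun y => y ^ 1 * p y) x =
      x * iteratedDeriv (j + 1) p x + (j + 1) * iteratedDeriv j p x := by
  simp only [pow_one]
  rw [iteratedDeriv_fun_mul contDiffAt_fun_id hp, Finset.sum_range_succ', Finset.sum_range_succ']
  simp [iteratedDeriv_fun_id]
  ring

-- With `s = It/n`, the bracket is `n^4 A²B²` for `A = 1 - (1 + ρ)s` and `B = 1 + (1 - ρ)s`, the
-- linear factors whose inverses make up `meanLogDeriv`: indeed `AB = 1 - 2ρs - (1 - ρ²)s²`.
open Complex in
lemma meanLogDeriv_polynomial_relation (μX μY ρ : ℝ) {n : ℕ} (hn : 1 ≤ n) (t : ℝ) :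
    ((n ^ 4 + (-4 * ρ * n ^ 3) * (I * t) + (6 * ρ ^ 2 - 2) * n ^ 2 * (I * t) ^ 2 +
        4 * ρ * (1 - ρ ^ 2) * n * (I * t) ^ 3 + (1 - ρ ^ 2) ^ 2 * (I * t) ^ 4) *
          meanLogDeriv μX μY ρ n t : ℂ) =
      n ^ 4 * (μX * μY + ρ) -
        n ^ 3 * (2 * ρ * μX * μY - μX ^ 2 - μY ^ 2 + 3 * ρ ^ 2 - 1) * (I * t) -
        n ^ 2 * (3 * ρ * (1 - ρ ^ 2) + ρ * μY ^ 2 - ρ ^ 2 * μX * μY - μX * μY + ρ * μX ^ 2) *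
          (I * t) ^ 2 - n * (1 - ρ ^ 2) ^ 2 * (I * t) ^ 3 := by
  have hn0 : (n : ℂ) ≠ 0 := by exact_mod_cast (by omega : n ≠ 0)
  obtain ⟨s, hs⟩ : ∃ s : ℂ, I * t = n * s := ⟨I * t / n, by field_simp⟩
  have h1 := one_add_mul_I_ne_zero (-(1 + ρ) / n) t
  have h2 := one_add_mul_I_ne_zero ((1 - ρ) / n) t
  rw [meanLogDeriv]
  push_cast at h1 h2 ⊢
  rw [hs] at h1 h2 ⊢
  have e1 : (1 + -(1 + ρ) / n * (n * s) : ℂ) = 1 - (1 + ρ) * s := by field_simp; ring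
  have e2 : (1 + (1 - ρ) / n * (n * s) : ℂ) = 1 + (1 - ρ) * s := by field_simp
  rw [e1] at h1 ⊢
  rw [e2] at h2 ⊢
  have key : ∀ A B p q r m : ℂ, A ≠ 0 → B ≠ 0 →
      A ^ 2 * B ^ 2 * (p * A⁻¹ + q * (A⁻¹ * A⁻¹) + (r * B⁻¹ + m * (B⁻¹ * B⁻¹))) =
        p * A * B ^ 2 + q * B ^ 2 + r * A ^ 2 * B + m * A ^ 2 := by
    intro A B p q r m hA hB
    field_simp
    ring
  have := key _ _ ((1 + ρ) / 2) (((μX + μY) / 2) ^ 2) (-((1 - ρ) / 2)) (-((μX - μY) / 2) ^ 2) h1 h2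
  linear_combination (n : ℂ) ^ 4 * this

theorem mainTheorem4 {Ω : Type*} [MeasurableSpace Ω] (P : Measure Ω) [IsProbabilityMeasure P]
    (μX μY ρ : ℝ) (hρ : ρ ∈ Set.Ioo (-1 : ℝ) 1) (n : ℕ) (hn : 1 ≤ n)
    (Z : Fin n → Ω → ℝ) (hlaw : ∀ i, HasLaw (Z i) (productNormal μX μY 1 1 ρ) P)
    (hindep : iIndepFun Z P) :
    (∃ p : ℝ → ℝ, IsPDF p (fun w => (n : ℝ)⁻¹ * ∑ i, Z i w) P ∧ ContDiffOn ℝ ∞ p {0}ᶜ) ∧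
    ∀ p : ℝ → ℝ, IsPDF p (fun w => (n : ℝ)⁻¹ * ∑ i, Z i w) P →
      ∀ x : ℝ, ContDiffAt ℝ 4 p x →
        (1 - ρ ^ 2) ^ 2 * x * iteratedDeriv 4 p x
        + (1 - ρ ^ 2) * ((1 - ρ ^ 2) * (4 - (n : ℝ)) - 4 * ρ * n * x) * iteratedDeriv 3 p x
        + n * ((6 * ρ ^ 2 - 2) * n * x - 12 * ρ * (1 - ρ ^ 2)
            + n * (3 * ρ * (1 - ρ ^ 2) + ρ * μY ^ 2 - ρ ^ 2 * μX * μY - μX * μY + ρ * μX ^ 2))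
          * iteratedDeriv 2 p x
        + n ^ 2 * (2 * (6 * ρ ^ 2 - 2)
            - n * (2 * ρ * μX * μY - μX ^ 2 - μY ^ 2 + 3 * ρ ^ 2 - 1) + 4 * ρ * n * x)
          * iteratedDeriv 1 p x
        + n ^ 3 * (4 * ρ + n * (x - μX * μY - ρ)) * p x = 0 := by
  have hm : AEMeasurable (fun w => (n : ℝ)⁻¹ * ∑ i, Z i w) P :=
    (Finset.aemeasurable_fun_sum _ fun i _ => (hlaw i).aemeasurable).const_mul _
  have hmem : ∀ k : ℕ, MemLp id k (P.map fun w => (n : ℝ)⁻¹ * ∑ i, Z i w) :=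
    memLp_id_map_mean hρ hlaw
  have hac := map_mean_absolutelyContinuous hρ hn hlaw hindep
  have hchar := charFun_map_mean hlaw hindep
  have hprob : IsProbabilityMeasure (P.map fun w => (n : ℝ)⁻¹ * ∑ i, Z i w) :=
    Measure.isProbabilityMeasure_map hm
  constructor
  · generalize hμ : (P.map fun w => (n : ℝ)⁻¹ * ∑ i, Z i w) = μ at *
    -- The Radon–Nikodym derivative is finite almost everywhere, so passing to real values loses
    -- nothing.
    have hp : μ = volume.withDensity fun x => ENNReal.ofReal (μ.rnDeriv volume x).toReal := by
      conv_lhs => rw [← Measure.withDensity_rnDeriv_eq μ volume hac]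
      refine withDensity_congr_ae ?_
      filter_upwards [μ.rnDeriv_lt_top volume] with x hx
      rw [ENNReal.ofReal_toReal hx.ne]
    have hpm : Measurable fun x => (μ.rnDeriv volume x).toReal :=
      (Measure.measurable_rnDeriv _ _).ennreal_toReal
    obtain ⟨q, hqm, hq0, hqp, hqs⟩ := exists_contDiffOn_ae_eq_of_fourier_decay
      (p := fun x => (μ.rnDeriv volume x).toReal) (fun x => ENNReal.toReal_nonneg)
      (fun k => integrable_pow_mul_density hpm (fun x => ENNReal.toReal_nonneg) hp (hmem k))
      (fun k => by
        obtain ⟨D, hD⟩ := exists_norm_iteratedDeriv_charFun_productNormal_pow_le μX μY hρ hn k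
        refine ⟨D, fun ξ => ?_⟩
        have hD0 : 0 ≤ D := by
          have := (norm_nonneg _).trans (hD 0)
          simpa using this
        rw [fourier_pow_mul_eq_iteratedDeriv_charFun hpm (fun x => ENNReal.toReal_nonneg) hp
          (hmem k), hchar, norm_mul, norm_pow, norm_neg, Complex.norm_I, one_pow, one_mul]
        refine (hD _).trans ?_
        rw [abs_neg, abs_mul, abs_of_pos Real.two_pi_pos]
        gcongr
        nlinarith [abs_nonneg ξ, Real.pi_gt_three])
    refine ⟨q, ⟨hqm, hq0, ⟨hm, ?_⟩⟩, hqs⟩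
    rw [hμ, hp]
    refine withDensity_congr_ae ?_
    filter_upwards [hqp] with x hx
    rw [hx]
  · intro p hpdf x hpx
    have hp := hpdf.hasLaw.map_eq
    have hF0 := fun ξ => fourier_pow_mul_eq_iteratedDeriv_charFun hpdf.measurable hpdf.nonneg hp
      (hmem 0) ξ
    have hF1 := fun ξ => fourier_pow_mul_eq_iteratedDeriv_charFun hpdf.measurable hpdf.nonneg hp
      (hmem 1) ξ
    have hi0 := integrable_pow_mul_density hpdf.measurable hpdf.nonneg hp (hmem 0)
    have hi1 := integrable_pow_mul_density hpdf.measurable hpdf.nonneg hp (hmem 1)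
    simp only [pow_zero, one_mul, iteratedDeriv_zero] at hF0 hi0
    simp only [iteratedDeriv_one] at hF1
    rw [hchar] at hF0 hF1
    -- `a` and `b` list the coefficients of the powers of `It` in the polynomial relation: `a`
    -- multiplies the transform of `x p`, and `b`, moved to the same side, that of `p`.
    let a : ℕ → ℝ := fun j => match j with
      | 0 => n ^ 4
      | 1 => -4 * ρ * n ^ 3
      | 2 => (6 * ρ ^ 2 - 2) * n ^ 2
      | 3 => 4 * ρ * (1 - ρ ^ 2) * n
      | 4 => (1 - ρ ^ 2) ^ 2
      | _ => 0
    let b : ℕ → ℝ := fun j => match j with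
      | 0 => -(n ^ 4 * (μX * μY + ρ))
      | 1 => n ^ 3 * (2 * ρ * μX * μY - μX ^ 2 - μY ^ 2 + 3 * ρ ^ 2 - 1)
      | 2 => n ^ 2 * (3 * ρ * (1 - ρ ^ 2) + ρ * μY ^ 2 - ρ ^ 2 * μX * μY - μX * μY + ρ * μX ^ 2)
      | 3 => n * (1 - ρ ^ 2) ^ 2
      | _ => 0
    have hp4 : ∀ k : ℕ, k ≤ 4 → ContDiffAt ℝ (k : ℕ) p x := fun k hk =>
      hpx.of_le (by exact_mod_cast hk)
    have key := sum_iteratedDeriv_eq_zero_of_fourier (N := 4) (a := a) (b := b) (x₀ := x) hi1 hi0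
      (fun ξ => by
        -- The Fourier transform at `ξ` is the characteristic function at `t = -2πξ`, so `It` is the
        -- multiplier `-2πIξ`.
        have hrel := meanLogDeriv_polynomial_relation μX μY ρ hn (-(2 * Real.pi * ξ))
        have hI : (-2 * Real.pi * Complex.I * ξ : ℂ) =
            Complex.I * ((-(2 * Real.pi * ξ) : ℝ) : ℂ) := by push_cast; ring
        rw [hI, hF0, hF1, (hasDerivAt_charFun_productNormal_pow μX μY hρ hn _).deriv]
        beta_reduce
        generalize (-(2 * Real.pi * ξ) : ℝ) = t at *
        generalize charFun (productNormal μX μY 1 1 ρ) ((n : ℝ)⁻¹ * t) ^ n = φ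
        have hII : (-Complex.I) ^ 1 * (φ * (Complex.I * meanLogDeriv μX μY ρ n t)) =
            φ * meanLogDeriv μX μY ρ n t := by
          linear_combination (-(φ * meanLogDeriv μX μY ρ n t)) * Complex.I_mul_I
        rw [hII]
        simp only [Finset.sum_range_succ, Finset.sum_range_zero, a, b]
        push_cast
        linear_combination φ * hrel)
      ((contDiffAt_fun_id.pow 1).mul (hp4 4 le_rfl)) (hp4 4 le_rfl)
    -- Leibniz turns the `j`-th derivative of `x p` into `x p^(j) + j p^(j-1)`; the second term
    -- produces the contributions free of both `x` and the means, such as `4(1 - ρ²)²` at order 3.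
    simp only [Finset.sum_range_succ, Finset.sum_range_zero, a, b,
      iteratedDeriv_succ_id_mul (hp4 1 (by norm_num)), iteratedDeriv_succ_id_mul (hp4 2 (by norm_num)),
      iteratedDeriv_succ_id_mul (hp4 3 (by norm_num)), iteratedDeriv_succ_id_mul (hp4 4 le_rfl),
      iteratedDeriv_zero] at key
    push_cast at key
    linear_combination key
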